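/- Let $r_1, r_2 \ge 1$ be integers. A digraph with vertex set $[k]=\{1,\dots,k\}$ is a *tournament* if it has no loops and exactly one of the arrows $(i,j)$, $(j,i)$ for any two distinct vertices $i,j$. It is *$(r_1,r_2)$-directional* if for every set $A\subset[k]$ with $|A|=r_1$ there is a set $B\subset[k]\setminus A$ with $|B|=r_2$ such that $(i,j)$ is an arrow for all $i\in A$, $j\in B$. Let $$\mathcal S(r_1,r_2)=\inf\{k\ge r_1+r_2:\ \text{there is an } (r_1,r_2)\text{-directional tournament on } [k]\}.$$ A *1-dependent uniform chain* is a stationary Markov chain $\mathbf X=(X_m)_{m\ge 0}$ on a finite state space such that all entries of the square of its transition matrix are equal. A *hitting time* on $\mathbf X$ is a random variable $T=\inf\{m\ge 0: X_m\in F\}$, where $F$ is a set of states. A family $T_1,\dots,T_n$ is *no-tie* if $\mathbb P(T_i=T_j)=0$ for $i\neq j$. For $A\subset[n]$ put $T^{(A)}=\min_{i\in A}T_i$. Let $n\ge r_1+r_2$, let $\mathbf X$ be a 1-dependent uniform chain and let $\mathcal T_n=\{T_1,\dots,T_n\}$ be a no-tie family of identically distributed hitting times on $\mathbf X$. The zero-sum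 game $G_{r_1,r_2}(\mathbf X,\mathcal T_n)$ is played as follows. Player I chooses $A\subset[n]$ with $|A|=r_1$; then Player II chooses $B\subset[n]\setminus A$ with $|B|=r_2$; then Player I chooses nonempty sets $A'\subset A$ and $B'\subset B$. If $T^{(A')}<T^{(B')}$, Player II pays $|B'|$ to Player I; otherwise Player I pays $|A'|$ to Player II. The game is *favorable to Player II* if the expected payoff of Player II is positive when both players play optimally, that is, if $$\min_{A}\ \max_{B}\ \min_{A',B'}\ \Big(|A'|\,\mathbb P\big(T^{(A')}>T^{(B')}\big)-|B'|\,\mathbb P\big(T^{(A')}<T^{(B')}\big)\Big)>0 .$$ **Theorem.** The infimum $\mathcal S(r_1,r_2)$ is finite, i.e. it is taken over a nonempty set. For every $n\in\mathbb N$, there exist a 1-dependent uniform chain $\mathbf X$ and a no-tie family $\mathcal T_n$ of $n$ identically distributed hitting times on $\mathbf X$ for which the game $G_{r_1,r_2}(\mathbf X,\mathcal T_n)$ is defined (that is, $n\ge r_1+r_2$) and favorable to Player II if and only if $n\ge\mathcal S(r_1,r_2)$. -/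

import Mathlib

open MeasureTheory ProbabilityTheory

universe u v

namespace PenneyGame

/-! ### Uniform one-dependent Markov chains -/

/-- `P` is a transition matrix (row-stochastic matrix) on the finite set `S`. -/
def IsTransitionMatrix {S : Type*} [Fintype S] (P : Matrix S S ℝ) : Prop :=
  (∀ s t, 0 ≤ P s t) ∧ ∀ s, ∑ t, P s t = 1

/-- The process `X` with values in the finite set `S` is a (time-homogeneous) Markov chain with
transition matrix `P`: its finite-dimensional laws are
`ℙ(X₀ = x₀, …, X_m = x_m) = ℙ(X₀ = x₀) P(x₀, x₁) ⋯ P(x_{m-1}, x_m)`. -/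
structure IsMarkovChain {Ω S : Type*} [MeasurableSpace Ω] [Fintype S] [MeasurableSpace S]
    (μ : Measure Ω) (X : ℕ → Ω → S) (P : Matrix S S ℝ) : Prop where
  isTransitionMatrix : IsTransitionMatrix P
  measurable : ∀ m, Measurable (X m)
  path_law : ∀ (m : ℕ) (x : ℕ → S),
    μ.real {ω | ∀ i ≤ m, X i ω = x i} =
      μ.real {ω | X 0 ω = x 0} * ∏ i ∈ Finset.range m, P (x i) (x (i + 1))

/-- A 1-dependent uniform chain: a Markov chain which is stationary (the law of `X m` does not
depend on the time `m`) and for which the square of the transition matrix has all its entries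
equal. -/
def IsOneDependentUniformChain {Ω S : Type*} [MeasurableSpace Ω] [Fintype S] [MeasurableSpace S]
    (μ : Measure Ω) (X : ℕ → Ω → S) : Prop :=
  ∃ P : Matrix S S ℝ, IsMarkovChain μ X P ∧ (∀ m, IdentDistrib (X m) (X 0) μ μ) ∧
    ∃ c : ℝ, ∀ s t, (P * P) s t = c

/-- The hitting time `inf {m ≥ 0 : X_m ∈ F}`, equal to `∞` if `F` is never visited. -/
noncomputable def hitTime {Ω S : Type*} (X : ℕ → Ω → S) (F : Set S) : Ω → ℕ∞ :=
  hittingAfter X F 0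

/-! ### The game -/

section Game

variable {Ω : Type*} [MeasurableSpace Ω] {n : ℕ}

/-- Any two distinct members of the family are equal with probability zero. -/
def NoTie (μ : Measure Ω) (T : Fin n → Ω → ℕ∞) : Prop :=
  ∀ i j, i ≠ j → ∀ᵐ ω ∂μ, T i ω ≠ T j ω

/-- All members of the family have the same law. -/
def IdenticallyDistributed (μ : Measure Ω) (T : Fin n → Ω → ℕ∞) : Prop :=
  ∀ i j, IdentDistrib (T i) (T j) μ μ

/-- The earliest time `min {T i : i ∈ A}`. -/
noncomputable def minTime (T : Fin n → Ω → ℕ∞) (A : Finset (Fin n)) (ω : Ω) : ℕ∞ :=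
  A.inf fun i => T i ω

open Classical in
/-- The amount that Player I pays to Player II when the final choice is `(A', B')`:
if `min_{A'} T < min_{B'} T`, Player II pays `|B'|` to Player I, otherwise Player I pays
`|A'|` to Player II. -/
noncomputable def payoff (T : Fin n → Ω → ℕ∞) (A' B' : Finset (Fin n)) (ω : Ω) : ℝ :=
  if minTime T A' ω < minTime T B' ω then -(B'.card : ℝ) else (A'.card : ℝ)

/-- The expected payoff of Player II. -/
noncomputable def expectedPayoff (μ : Measure Ω) (T : Fin n → Ω → ℕ∞)
    (A' B' : Finset (Fin n)) : ℝ :=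
  ∫ ω, payoff T A' B' ω ∂μ

/-- First choice of Player I: a set of `r₁` indices. -/
abbrev FirstMove (n r₁ : ℕ) : Type :=
  {A : Finset (Fin n) // A.card = r₁}

/-- Reply of Player II: a set of `r₂` indices which is disjoint from `A`. -/
abbrev Reply (r₂ : ℕ) (A : Finset (Fin n)) : Type :=
  {B : Finset (Fin n) // B.card = r₂ ∧ Disjoint A B}

/-- Final choice of Player I: nonempty subsets `A' ⊆ A` and `B' ⊆ B`. -/
abbrev FinalMove (A B : Finset (Fin n)) : Type :=
  {C : Finset (Fin n) × Finset (Fin n) // (C.1.Nonempty ∧ C.1 ⊆ A) ∧ (C.2.Nonempty ∧ C.2 ⊆ B)}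

/-- The expected payoff of Player II when both players play optimally: Player I
minimises over `A`, then Player II maximises over `B`, then Player I minimises over `(A', B')`.
For `1 ≤ r₁`, `1 ≤ r₂` and `r₁ + r₂ ≤ n` every set of moves is finite and nonempty, so that all
infima and suprema are attained. -/
noncomputable def gameValue (μ : Measure Ω) (T : Fin n → Ω → ℕ∞) (r₁ r₂ : ℕ) : ℝ :=
  ⨅ A : FirstMove n r₁, ⨆ B : Reply r₂ A.1, ⨅ C : FinalMove A.1 B.1,
    expectedPayoff μ T C.1.1 C.1.2

/-- The game with parameters `r₁, r₂`, which is defined for `r₁ + r₂ ≤ n` only, is favorable to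
Player II. -/
def IsFavorable (μ : Measure Ω) (T : Fin n → Ω → ℕ∞) (r₁ r₂ : ℕ) : Prop :=
  r₁ + r₂ ≤ n ∧ 0 < gameValue μ T r₁ r₂

end Game

/-! ### Directional tournaments -/

/-- A tournament: no loops, and exactly one of the two arrows between distinct vertices. -/
def IsTournament {V : Type*} (G : Digraph V) : Prop :=
  (∀ v, ¬ G.Adj v v) ∧ ∀ u v, u ≠ v → Xor (G.Adj u v) (G.Adj v u)

/-- Every set `A` of `r₁` vertices has a disjoint set `B` of `r₂` vertices such that all arrows
from `A` to `B` are present. -/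
def IsDirectional {V : Type*} (G : Digraph V) (r₁ r₂ : ℕ) : Prop :=
  ∀ A : Finset V, A.card = r₁ →
    ∃ B : Finset V, B.card = r₂ ∧ Disjoint A B ∧ ∀ i ∈ A, ∀ j ∈ B, G.Adj i j

/-- The numbers `k ≥ r₁ + r₂` of vertices of `(r₁, r₂)`-directional tournaments. -/
def directionalOrders (r₁ r₂ : ℕ) : Set ℕ :=
  {k | r₁ + r₂ ≤ k ∧ ∃ G : Digraph (Fin k), IsTournament G ∧ IsDirectional G r₁ r₂}

/-- The least number of vertices, at least `r₁ + r₂`, of an `(r₁, r₂)`-directional tournament. -/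
noncomputable def threshold (r₁ r₂ : ℕ) : ℕ :=
  sInf (directionalOrders r₁ r₂)

end PenneyGame

open PenneyGame

/-! If the game is favorable to Player II, draw an arrow `i → j` when `T j` is more likely to
precede `T i` than conversely. As the payoff must already be positive for the single bets
`A' = {i}`, `B' = {j}`, the reply `B` of Player II to `A` receives all arrows from `A`. Hence the
arrows form a directional digraph, which is completed to a tournament.

Conversely, let `G` be a directional tournament on `n` vertices. The chain consists of the pairs of
consecutive letters of a sequence of independent uniform letters, and `T i` waits for one of the `n`
words `(i, j)`, where `j` is a vertex. The second letter of one word can be the first letter of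
another one, and then waiting for a set of words containing both favors the former over the latter:
the renewal equation gives the latter the smaller chance of being the first word to occur. The
letters are arranged so that the word `(j, i)` chains into the word `(i, j)` exactly when `i → j`,
so every arrow from `i` to a competitor lowers the chances of `i` by the same amount. Thus `A'`
loses at least `|A'| |B'|` of these units against `B'`, which itself loses less than `|B'| ^ 2`,
and this is what makes the expected payoff positive.

A directional digraph remains directional when its vertices are replaced by independent sets, so it
suffices to find one of them. An explicit one has vertices that carry a short list of labels, which
can be chosen so as to receive arrows from all members of a given small set.
-/

namespace PenneyGame

section Tournaments

variable {V W : Type*} {G : Digraph V} {r₁ r₂ : ℕ}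

lemma IsTournament.not_adj_of_adj (hG : IsTournament G) {u v : V} (h : G.Adj u v) :
    ¬ G.Adj v u := by
  have hne : u ≠ v := fun huv => hG.1 v (huv ▸ h)
  rcases hG.2 u v hne with h' | h'
  · exact h'.2
  · exact absurd h h'.2

/-- The digraph `G` together with an arrow `u → v` for every pair `u < v` of vertices which are
not joined in `G`. It is a tournament whenever `G` has no pair of opposite arrows. -/
def tournamentCompletion [LT V] (G : Digraph V) : Digraph V where
  Adj u v := G.Adj u v ∨ (¬ G.Adj v u ∧ u < v)

lemma isTournament_tournamentCompletion [LinearOrder V] (hG : ∀ u v, G.Adj u v → ¬ G.Adj v u) :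
    IsTournament (tournamentCompletion G) := by
  refine ⟨fun v => ?_, fun u v huv => ?_⟩
  · simpa [tournamentCompletion] using fun h => hG v v h h
  · have := hG u v
    rcases lt_or_gt_of_ne huv with h | h <;>
      simp only [tournamentCompletion, Xor, h, h.not_gt] <;> tauto

lemma IsDirectional.mono {H : Digraph V} (hGH : G ≤ H) (hG : IsDirectional G r₁ r₂) :
    IsDirectional H r₁ r₂ := by
  intro A hA
  obtain ⟨B, hB, hAB, hadj⟩ := hG A hA
  exact ⟨B, hB, hAB, fun i hi j hj => hGH (hadj i hi j hj)⟩

lemma mem_directionalOrders_of_not_adj_of_adj {n : ℕ} (hn : r₁ + r₂ ≤ n) {G : Digraph (Fin n)}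
    (hG : ∀ u v, G.Adj u v → ¬ G.Adj v u) (hdir : IsDirectional G r₁ r₂) :
    n ∈ directionalOrders r₁ r₂ :=
  ⟨hn, tournamentCompletion G, isTournament_tournamentCompletion hG,
    hdir.mono fun _ _ => Or.inl⟩

/-- The inverse image of a digraph: every vertex `v` is replaced by the fibre of `v`, without
arrows inside of the fibres if `G` has no loops. -/
def digraphComap (π : W → V) (G : Digraph V) : Digraph W where
  Adj x y := G.Adj (π x) (π y)

lemma IsDirectional.comap [Fintype V] {π : W → V} (hπ : Function.Surjective π)
    (hr₁ : r₁ ≤ Fintype.card V) (hG : IsDirectional G r₁ r₂) :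
    IsDirectional (digraphComap π G) r₁ r₂ := by
  classical
  intro A hA
  obtain ⟨A', hAA', hA'⟩ := Finset.exists_superset_card_eq (s := A.image π) (n := r₁)
    (hA ▸ Finset.card_image_le) hr₁
  obtain ⟨B, hB, hdisj, hadj⟩ := hG A' hA'
  obtain ⟨σ, hσ⟩ := hπ.hasRightInverse
  have hmem : ∀ i ∈ A, π i ∈ A' := fun i hi => hAA' (Finset.mem_image_of_mem π hi)
  refine ⟨B.image σ, (Finset.card_image_of_injective B hσ.injective).trans hB, ?_, ?_⟩
  · refine Finset.disjoint_right.2 fun x hx hxA => ?_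
    obtain ⟨b, hb, rfl⟩ := Finset.mem_image.1 hx
    exact Finset.disjoint_left.1 hdisj (hmem _ hxA) ((hσ b).symm ▸ hb)
  · intro i hi x hx
    obtain ⟨b, hb, rfl⟩ := Finset.mem_image.1 hx
    have h := hadj _ (hmem i hi) b hb
    rwa [← hσ b] at h

lemma mem_directionalOrders_of_surjective [Fintype V] (hG : ∀ u v, G.Adj u v → ¬ G.Adj v u)
    (hdir : IsDirectional G r₁ r₂) (hr : r₁ + r₂ ≤ Fintype.card V) {n : ℕ} {π : Fin n → V}
    (hπ : Function.Surjective π) : n ∈ directionalOrders r₁ r₂ := by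
  have hcard : Fintype.card V ≤ n := by simpa using Fintype.card_le_of_surjective π hπ
  exact mem_directionalOrders_of_not_adj_of_adj (hr.trans hcard) (fun u v => hG (π u) (π v))
    (hdir.comap hπ (by omega))

lemma mem_directionalOrders_of_le {k n : ℕ} (hr₁ : 1 ≤ r₁) (hk : k ∈ directionalOrders r₁ r₂)
    (hkn : k ≤ n) : n ∈ directionalOrders r₁ r₂ := by
  obtain ⟨hr, G, hG, hdir⟩ := hk
  have : NeZero k := ⟨by omega⟩
  exact mem_directionalOrders_of_surjective (fun u v => hG.not_adj_of_adj) hdir (by simpa)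
    (Function.invFun_surjective (Fin.castLE_injective hkn))

/-- Common out-neighbours of larger and larger sets can be added one at a time. -/
lemma isDirectional_of_forall_exists_adj (hG : ∀ v, ¬ G.Adj v v)
    (h : ∀ A : Finset V, A.card ≤ r₁ + r₂ → ∃ v, ∀ u ∈ A, G.Adj u v) :
    IsDirectional G r₁ r₂ := by
  classical
  intro A hA
  suffices H : ∀ s ≤ r₂, ∃ B : Finset V, B.card = s ∧ Disjoint A B ∧
      ∀ i ∈ A, ∀ j ∈ B, G.Adj i j from H r₂ le_rfl
  intro s
  induction s with
  | zero => exact fun _ => ⟨∅, by simp⟩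
  | succ s ih =>
    intro hs
    obtain ⟨B, hB, hAB, hadj⟩ := ih (by omega)
    obtain ⟨v, hv⟩ := h (A ∪ B) (by have := Finset.card_union_le A B; omega)
    have hvAB : v ∉ A ∪ B := fun hmem => hG v (hv v hmem)
    rw [Finset.mem_union, not_or] at hvAB
    refine ⟨insert v B, by rw [Finset.card_insert_of_notMem hvAB.2, hB],
      Finset.disjoint_insert_right.2 ⟨hvAB.1, hAB⟩, fun i hi j hj => ?_⟩
    rcases Finset.mem_insert.1 hj with rfl | hj
    · exact hv i (Finset.mem_union_left B hi)
    · exact hadj i hi j hj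

/-- A vertex of the column digraph: its column, its list of at most `m` labels, and its label.
There are more than `m` columns, and more labels than `m` lists can contain. -/
abbrev ColumnVertex (m : ℕ) : Type :=
  Fin (m + 1) × {t : Finset (Fin (m * m + 1)) // t.card ≤ m} × Fin (m * m + 1)

/-- Two vertices of distinct columns are joined by an arrow, which leads from the vertex in the
higher column to the vertex in the lower column if the label of the former is in the list of the
latter. -/
def columnDigraph (m : ℕ) : Digraph (ColumnVertex m) where
  Adj x y := (y.1 < x.1 ∧ x.2.2 ∈ y.2.1.1) ∨ (x.1 < y.1 ∧ y.2.2 ∉ x.2.1.1)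

lemma columnDigraph_not_adj_of_adj {m : ℕ} (x y : ColumnVertex m)
    (h : (columnDigraph m).Adj x y) : ¬ (columnDigraph m).Adj y x := by
  rcases h with ⟨hlt, h⟩ | ⟨hlt, h⟩ <;> simp [columnDigraph, hlt.not_gt, h]

lemma exists_adj_columnDigraph {m : ℕ} (A : Finset (ColumnVertex m)) (hA : A.card ≤ m) :
    ∃ v, ∀ x ∈ A, (columnDigraph m).Adj x v := by
  have hcolumns : (A.image Prod.fst).card ≤ m := Finset.card_image_le.trans hA
  have hlabels : (A.biUnion fun x => x.2.1.1).card ≤ m * m :=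
    (Finset.card_biUnion_le_card_mul _ _ _ fun x _ => x.2.1.2).trans (Nat.mul_le_mul_right m hA)
  obtain ⟨i, -, hi⟩ := Finset.exists_mem_notMem_of_card_lt_card (t := Finset.univ)
    (hcolumns.trans_lt (by simp))
  obtain ⟨l, -, hl⟩ := Finset.exists_mem_notMem_of_card_lt_card (t := Finset.univ)
    (hlabels.trans_lt (by simp))
  refine ⟨(i, ⟨A.image fun x => x.2.2, Finset.card_image_le.trans hA⟩, l), fun x hx => ?_⟩
  have hxi : x.1 ≠ i := fun h => hi (h ▸ Finset.mem_image_of_mem Prod.fst hx)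
  rcases lt_or_gt_of_ne hxi with hlt | hlt
  · exact Or.inr ⟨hlt, fun h => hl (Finset.mem_biUnion.2 ⟨x, hx, h⟩)⟩
  · exact Or.inl ⟨hlt, Finset.mem_image_of_mem (fun x => x.2.2) hx⟩

theorem directionalOrders_nonempty (r₁ r₂ : ℕ) : (directionalOrders r₁ r₂).Nonempty := by
  have hcard : r₁ + r₂ + 1 ≤ Fintype.card (ColumnVertex (r₁ + r₂)) := by
    simpa using Fintype.card_le_of_injective
      (fun i => (i, ⟨∅, by simp⟩, 0) : Fin (r₁ + r₂ + 1) → ColumnVertex (r₁ + r₂))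
      fun i j h => congrArg Prod.fst h
  exact ⟨_, mem_directionalOrders_of_surjective columnDigraph_not_adj_of_adj
    (isDirectional_of_forall_exists_adj (fun v h => columnDigraph_not_adj_of_adj v v h h)
      exists_adj_columnDigraph)
    (Nat.le_of_succ_le hcard) (Fintype.equivFin _).symm.surjective⟩

end Tournaments

section Game

variable {Ω : Type*} [MeasurableSpace Ω] {μ : Measure Ω} {n r₁ r₂ : ℕ} {T : Fin n → Ω → ℕ∞}

lemma ciInf_pos_iff_of_finite {ι : Type*} [Finite ι] [Nonempty ι] {f : ι → ℝ} :
    0 < ⨅ i, f i ↔ ∀ i, 0 < f i := by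
  refine ⟨fun h i => h.trans_le (ciInf_le (Set.finite_range f).bddBelow i), fun h => ?_⟩
  obtain ⟨i, hi⟩ := exists_eq_ciInf_of_finite (f := f)
  exact hi ▸ h i

lemma ciSup_pos_iff_of_finite {ι : Type*} [Finite ι] [Nonempty ι] {f : ι → ℝ} :
    0 < ⨆ i, f i ↔ ∃ i, 0 < f i :=
  lt_ciSup_iff (Set.finite_range f).bddAbove

lemma nonempty_firstMove (h : r₁ ≤ n) : Nonempty (FirstMove n r₁) := by
  obtain ⟨A, -, hA⟩ := Finset.exists_subset_card_eq (s := (Finset.univ : Finset (Fin n)))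
    (n := r₁) (by simpa)
  exact ⟨A, hA⟩

lemma nonempty_reply {A : Finset (Fin n)} (h : A.card + r₂ ≤ n) : Nonempty (Reply r₂ A) := by
  obtain ⟨B, hBA, hB⟩ := Finset.exists_subset_card_eq (s := Aᶜ) (n := r₂)
    (by rw [Finset.card_compl, Fintype.card_fin]; omega)
  exact ⟨B, hB, Finset.subset_compl_iff_disjoint_left.1 hBA⟩

lemma nonempty_finalMove {A B : Finset (Fin n)} (hA : A.Nonempty) (hB : B.Nonempty) :
    Nonempty (FinalMove A B) :=
  ⟨(A, B), ⟨hA, subset_rfl⟩, hB, subset_rfl⟩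

lemma gameValue_pos_iff (hr₁ : 1 ≤ r₁) (hr₂ : 1 ≤ r₂) (hn : r₁ + r₂ ≤ n) :
    0 < gameValue μ T r₁ r₂ ↔ ∀ A : Finset (Fin n), A.card = r₁ →
      ∃ B : Finset (Fin n), B.card = r₂ ∧ Disjoint A B ∧
        ∀ A' ⊆ A, ∀ B' ⊆ B, A'.Nonempty → B'.Nonempty → 0 < expectedPayoff μ T A' B' := by
  have := nonempty_firstMove (show r₁ ≤ n by omega)
  have hreply (A : FirstMove n r₁) : Nonempty (Reply r₂ A.1) := nonempty_reply (A.2.symm ▸ hn)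
  have hfinal (A : FirstMove n r₁) (B : Reply r₂ A.1) : Nonempty (FinalMove A.1 B.1) :=
    nonempty_finalMove (Finset.card_pos.1 (A.2.symm ▸ hr₁)) (Finset.card_pos.1 (B.2.1.symm ▸ hr₂))
  simp only [gameValue, ciInf_pos_iff_of_finite, ciSup_pos_iff_of_finite, Subtype.forall,
    Subtype.exists, Prod.forall, and_imp, exists_prop, and_assoc]
  exact forall₂_congr fun A _ => exists_congr fun B => and_congr_right' <| and_congr_right' <|
    ⟨fun h A' hA' B' hB' hA hB => h A' B' hA hA' hB hB',
      fun h A' B' hA hA' hB hB' => h A' hA' B' hB' hA hB⟩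

lemma aemeasurable_minTime (hT : ∀ i, AEMeasurable (T i) μ) (A : Finset (Fin n)) :
    AEMeasurable (minTime T A) μ :=
  (measurable_of_countable fun x : Fin n → ℕ∞ => A.inf x).comp_aemeasurable
    (aemeasurable_pi_lambda _ hT)

lemma expectedPayoff_eq [IsProbabilityMeasure μ] (hT : ∀ i, AEMeasurable (T i) μ)
    (A B : Finset (Fin n)) :
    expectedPayoff μ T A B =
      A.card * (1 - μ.real {ω | minTime T A ω < minTime T B ω}) -
        B.card * μ.real {ω | minTime T A ω < minTime T B ω} := by
  classical
  set E := {ω | minTime T A ω < minTime T B ω} with hE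
  have hnull : NullMeasurableSet E μ :=
    ((aemeasurable_minTime hT A).prodMk (aemeasurable_minTime hT B)).nullMeasurableSet_preimage
      (Set.to_countable {x : ℕ∞ × ℕ∞ | x.1 < x.2}).measurableSet
  have hpayoff : payoff T A B =
      fun ω => (A.card : ℝ) - E.indicator (fun _ => (A.card + B.card : ℝ)) ω := by
    ext ω
    by_cases h : minTime T A ω < minTime T B ω <;> simp [payoff, hE, h]
  rw [expectedPayoff, hpayoff, integral_sub (integrable_const _)
    ((integrable_const _).indicator₀ hnull), integral_indicator₀ hnull]
  simp only [integral_const, probReal_univ, measureReal_restrict_apply_univ, smul_eq_mul]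
  ring

lemma one_le_measureReal_lt_add_measureReal_gt [IsProbabilityMeasure μ] {τ σ : Ω → ℕ∞}
    (h : ∀ᵐ ω ∂μ, τ ω ≠ σ ω) : 1 ≤ μ.real {ω | τ ω < σ ω} + μ.real {ω | σ ω < τ ω} := by
  have hunion : ({ω | τ ω < σ ω} ∪ {ω | σ ω < τ ω} : Set Ω) =ᵐ[μ] Set.univ := by
    filter_upwards [h] with ω hω
    exact propext ⟨fun _ => trivial, fun _ => lt_or_gt_of_ne hω⟩
  calc 1 = μ.real ({ω | τ ω < σ ω} ∪ {ω | σ ω < τ ω}) := by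
        rw [measureReal_congr hunion, probReal_univ]
    _ ≤ _ := measureReal_union_le _ _

theorem mem_directionalOrders_of_isFavorable [IsProbabilityMeasure μ]
    (hT : ∀ i, AEMeasurable (T i) μ) (hnt : NoTie μ T) (hr₁ : 1 ≤ r₁) (hr₂ : 1 ≤ r₂)
    (hfav : IsFavorable μ T r₁ r₂) : n ∈ directionalOrders r₁ r₂ := by
  refine mem_directionalOrders_of_not_adj_of_adj hfav.1
    (G := ⟨fun i j => μ.real {ω | T i ω < T j ω} < μ.real {ω | T j ω < T i ω}⟩)
    (fun _ _ => lt_asymm) fun A hA => ?_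
  obtain ⟨B, hB, hAB, hpos⟩ := (gameValue_pos_iff hr₁ hr₂ hfav.1).1 hfav.2 A hA
  refine ⟨B, hB, hAB, fun i hi j hj => ?_⟩
  have hij : i ≠ j := Finset.disjoint_iff_ne.1 hAB i hi j hj
  have hpayoff := hpos {i} (by simpa) {j} (by simpa) (by simp) (by simp)
  simp only [expectedPayoff_eq hT, minTime, Finset.inf_singleton, Finset.card_singleton,
    Nat.cast_one, one_mul] at hpayoff
  have hsum := one_le_measureReal_lt_add_measureReal_gt (hnt i j hij)
  change μ.real {ω | T i ω < T j ω} < μ.real {ω | T j ω < T i ω}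
  linarith

end Game

section HittingTimes

variable {Ω S : Type*} {X : ℕ → Ω → S} {F G : Set S} {ω : Ω} {m : ℕ}

lemma natCast_le_hitTime_iff : m ≤ hitTime X F ω ↔ ∀ k < m, X k ω ∉ F := by
  refine ⟨fun h k hk => ?_, fun h => ?_⟩
  · exact notMem_of_lt_hittingAfter ((ENat.natCast_lt_natCast.2 hk).trans_le h) (Nat.zero_le k)
  · by_contra! hlt
    obtain ⟨k, hk, hkF⟩ := (hittingAfter_lt_iff (n := 0) (i := m)).1 hlt
    exact h k hk.2 hkF

lemma natCast_succ_le_hitTime_iff :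
    (m + 1 : ℕ) ≤ hitTime X F ω ↔ m ≤ hitTime X F ω ∧ X m ω ∉ F := by
  simp only [natCast_le_hitTime_iff, Nat.lt_succ_iff_lt_or_eq, or_imp, forall_and, forall_eq]

lemma hitTime_eq_natCast_iff : hitTime X F ω = m ↔ m ≤ hitTime X F ω ∧ X m ω ∈ F := by
  have hsucc := natCast_succ_le_hitTime_iff (X := X) (F := F) (ω := ω) (m := m)
  rw [Nat.cast_add, Nat.cast_one, ENat.natCast_add_one_le_iff] at hsucc
  grind

lemma minTime_hitTime {n : ℕ} (F : Fin n → Set S) (A : Finset (Fin n)) (ω : Ω) :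
    minTime (fun i => hitTime X (F i)) A ω = hitTime X (⋃ i ∈ A, F i) ω := by
  refine ENat.eq_of_forall_natCast_le_iff fun m => ?_
  simp only [minTime, Finset.le_inf_iff, natCast_le_hitTime_iff, Set.mem_iUnion, not_exists]
  exact ⟨fun h k hk i hi => h i hi k hk, fun h i hi k hk => h k hk i hi⟩

lemma hitTime_ne_of_disjoint (hFG : Disjoint F G) (h : hitTime X F ω ≠ ⊤) :
    hitTime X F ω ≠ hitTime X G ω := by
  obtain ⟨m, hm⟩ := ENat.ne_top_iff_exists.1 h
  intro heq
  exact Set.disjoint_left.1 hFG (hitTime_eq_natCast_iff.1 hm.symm).2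
    (hitTime_eq_natCast_iff.1 (hm.trans heq).symm).2

lemma hitTime_lt_hitTime_iff (hFG : Disjoint F G) :
    hitTime X F ω < hitTime X G ω ↔ ∃ m : ℕ, m ≤ hitTime X (F ∪ G) ω ∧ X m ω ∈ F := by
  have hunion (m : ℕ) : m ≤ hitTime X (F ∪ G) ω ↔ m ≤ hitTime X F ω ∧ m ≤ hitTime X G ω := by
    simp only [natCast_le_hitTime_iff, Set.mem_union, not_or, ← forall_and]
  refine ⟨fun h => ?_, fun ⟨m, hm, hmF⟩ => ?_⟩
  · obtain ⟨m, hm⟩ := ENat.ne_top_iff_exists.1 h.ne_top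
    exact ⟨m, (hunion m).2 ⟨hm.le, hm.le.trans h.le⟩, (hitTime_eq_natCast_iff.1 hm.symm).2⟩
  · obtain ⟨hF, hG⟩ := (hunion m).1 hm
    have hFm := hitTime_eq_natCast_iff.2 ⟨hF, hmF⟩
    exact lt_of_le_of_ne (hFm ▸ hG) (hitTime_ne_of_disjoint hFG (hFm ▸ ENat.natCast_ne_top m))

/-- The event that the process is in `w` at time `m` and has not visited `F` before. For `w ∈ F`
this says that the first visit to `F` occurs at time `m` and in the state `w`. -/
def entryEvent (X : ℕ → Ω → S) (F : Set S) (m : ℕ) (w : S) : Set Ω :=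
  {ω | m ≤ hitTime X F ω} ∩ X m ⁻¹' {w}

lemma disjoint_entryEvent {w w' : S} {m m' : ℕ} (hw : w ∈ F) (hw' : w' ∈ F)
    (h : (m, w) ≠ (m', w')) : Disjoint (entryEvent X F m w) (entryEvent X F m' w') := by
  refine Set.disjoint_left.2 fun ω ⟨hm, hmw⟩ ⟨hm', hmw'⟩ => h ?_
  obtain rfl : X m ω = w := hmw
  obtain rfl : X m' ω = w' := hmw'
  have hmm' : (m : ℕ∞) = m' :=
    (hitTime_eq_natCast_iff.2 ⟨hm, hw⟩).symm.trans (hitTime_eq_natCast_iff.2 ⟨hm', hw'⟩)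
  rw [ENat.natCast_inj.1 hmm']

lemma measurableSet_natCast_le_hitTime [MeasurableSpace S] {_ : MeasurableSpace Ω}
    (hX : ∀ k < m, Measurable (X k)) (hF : MeasurableSet F) :
    MeasurableSet {ω | m ≤ hitTime X F ω} := by
  simp only [natCast_le_hitTime_iff, Set.ofPred_forall]
  exact .biInter (Set.to_countable _) fun k hk => (hX k hk hF).compl

lemma generateFrom_Ici_natCast :
    MeasurableSpace.generateFrom (Set.range fun m : ℕ => Set.Ici (m : ℕ∞)) = ⊤ := by
  refine top_unique fun s _ => ?_
  let _ := MeasurableSpace.generateFrom (Set.range fun m : ℕ => Set.Ici (m : ℕ∞))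
  have hIci (m : ℕ) : MeasurableSet (Set.Ici (m : ℕ∞)) :=
    MeasurableSpace.measurableSet_generateFrom ⟨m, rfl⟩
  have hsingleton (x : ℕ∞) : MeasurableSet {x} := by
    induction x with
    | top =>
      rw [show {⊤} = ⋂ m : ℕ, Set.Ici (m : ℕ∞) by
        ext x; simp [ENat.eq_top_iff_forall_ge]]
      exact .iInter hIci
    | coe m =>
      rw [show {(m : ℕ∞)} = Set.Ici (m : ℕ∞) \ Set.Ici ((m + 1 : ℕ) : ℕ∞) by
        ext x
        simp only [Set.mem_singleton_iff, Set.mem_sdiff, Set.mem_Ici, Nat.cast_succ,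
          ENat.natCast_add_one_le_iff, not_lt]
        rw [le_antisymm_iff, and_comm]]
      exact (hIci m).diff (hIci (m + 1))
  rw [← Set.biUnion_of_singleton s]
  exact .biUnion s.to_countable fun x _ => hsingleton x

lemma isPiSystem_Ici_natCast : IsPiSystem (Set.range fun m : ℕ => Set.Ici (m : ℕ∞)) := by
  rintro _ ⟨m, rfl⟩ _ ⟨k, rfl⟩ -
  exact ⟨max m k, by simp [Set.Ici_inter_Ici, Nat.mono_cast.map_max]⟩

variable [MeasurableSpace Ω] {μ : Measure Ω}

lemma identDistrib_of_measureReal_natCast_le_eq [IsProbabilityMeasure μ] {τ σ : Ω → ℕ∞}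
    (hτ : Measurable τ) (hσ : Measurable σ)
    (h : ∀ m : ℕ, μ.real {ω | m ≤ τ ω} = μ.real {ω | m ≤ σ ω}) : IdentDistrib τ σ μ μ := by
  refine ⟨hτ.aemeasurable, hσ.aemeasurable, ?_⟩
  have := Measure.isProbabilityMeasure_map (μ := μ) hτ.aemeasurable
  refine ext_of_generate_finite _ generateFrom_Ici_natCast.symm isPiSystem_Ici_natCast ?_ ?_
  · rintro _ ⟨m, rfl⟩
    rw [Measure.map_apply hτ .of_discrete, Measure.map_apply hσ .of_discrete]
    exact (measureReal_eq_measureReal_iff).1 (h m)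
  · simp [Measure.map_apply, hσ]

/-- The probability that the set `F` is not visited before time `m`. -/
noncomputable def survivalProb (μ : Measure Ω) (X : ℕ → Ω → S) (F : Set S) (m : ℕ) : ℝ :=
  μ.real {ω | m ≤ hitTime X F ω}

/-- The probability that the process is in `w` at time `m` and has not visited `F` before. -/
noncomputable def entryProbAt (μ : Measure Ω) (X : ℕ → Ω → S) (F : Set S) (m : ℕ) (w : S) : ℝ :=
  μ.real (entryEvent X F m w)

/-- The probability that the process is in `w` at some time before which it has not visited `F`.
For `w ∈ F` this says that the first visit to `F` occurs in the state `w`. -/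
noncomputable def entryProb (μ : Measure Ω) (X : ℕ → Ω → S) (F : Set S) (w : S) : ℝ :=
  μ.real (⋃ m : ℕ, entryEvent X F m w)

lemma survivalProb_zero [IsProbabilityMeasure μ] : survivalProb μ X F 0 = 1 := by
  simp [survivalProb]

variable [MeasurableSpace S]

lemma measurable_hitTime (hX : ∀ m, Measurable (X m)) (hF : MeasurableSet F) :
    Measurable (hitTime X F) := by
  have h : Measurable[_, MeasurableSpace.generateFrom _] (hitTime X F) :=
    measurable_generateFrom (s := Set.range fun m : ℕ => Set.Ici (m : ℕ∞))
      (by rintro _ ⟨m, rfl⟩; exact measurableSet_natCast_le_hitTime (fun k _ => hX k) hF)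
  rwa [generateFrom_Ici_natCast] at h

variable [MeasurableSingletonClass S]

lemma measureReal_inter_preimage_finset [IsFiniteMeasure μ] (hX : ∀ m, Measurable (X m)) (m : ℕ)
    (D : Set Ω) (C : Finset S) : μ.real (D ∩ X m ⁻¹' C) = ∑ w ∈ C, μ.real (D ∩ X m ⁻¹' {w}) := by
  have h := sum_measureReal_preimage_singleton (μ := μ.restrict D) (f := X m) C
    fun w _ => hX m (measurableSet_singleton w)
  rw [measureReal_restrict_apply (hX m C.measurableSet)] at h
  rw [Set.inter_comm, ← h]
  refine Finset.sum_congr rfl fun w _ => ?_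
  rw [measureReal_restrict_apply (hX m (measurableSet_singleton w)), Set.inter_comm]

lemma survivalProb_succ_add [IsFiniteMeasure μ] (hX : ∀ m, Measurable (X m)) (F : Finset S)
    (m : ℕ) :
    survivalProb μ X F (m + 1) + ∑ w ∈ F, entryProbAt μ X F m w = survivalProb μ X F m := by
  have hsucc : {ω | (m + 1 : ℕ) ≤ hitTime X F ω} = {ω | m ≤ hitTime X F ω} \ X m ⁻¹' F :=
    Set.ext fun ω => natCast_succ_le_hitTime_iff
  simp only [survivalProb, entryProbAt, entryEvent]
  rw [hsucc, ← measureReal_inter_preimage_finset hX,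
    measureReal_sdiff_add_inter (hX m F.measurableSet)]

lemma measurableSet_entryEvent (hX : ∀ m, Measurable (X m)) (hF : MeasurableSet F)
    (m : ℕ) (w : S) : MeasurableSet (entryEvent X F m w) :=
  (measurableSet_natCast_le_hitTime (fun k _ => hX k) hF).inter (hX m (measurableSet_singleton w))

lemma hasSum_entryProbAt [IsFiniteMeasure μ] (hX : ∀ m, Measurable (X m))
    (hF : MeasurableSet F) {w : S} (hw : w ∈ F) :
    HasSum (fun m => entryProbAt μ X F m w) (entryProb μ X F w) := by
  have h := measure_iUnion (μ := μ)
    (fun m m' hmm' => disjoint_entryEvent hw hw (by simpa using hmm'))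
    fun m => measurableSet_entryEvent hX hF m w
  rw [entryProb, measureReal_def, h, ENNReal.tsum_toReal_eq fun _ => measure_ne_top _ _]
  exact (ENNReal.summable_toReal (h ▸ measure_ne_top _ _)).hasSum

lemma measureReal_hitTime_lt [IsFiniteMeasure μ] (hX : ∀ m, Measurable (X m)) {A B : Finset S}
    (hAB : Disjoint A B) :
    μ.real {ω | hitTime X A ω < hitTime X B ω} = ∑ w ∈ A, entryProb μ X (A ∪ B) w := by
  have hF : MeasurableSet (A ∪ B : Set S) := A.measurableSet.union B.measurableSet
  have hset : {ω | hitTime X A ω < hitTime X B ω} =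
      ⋃ w ∈ A, ⋃ m : ℕ, entryEvent X (A ∪ B) m w := by
    ext ω
    simp [entryEvent, hitTime_lt_hitTime_iff (Finset.disjoint_coe.2 hAB), and_comm]
  rw [hset, measureReal_biUnion_finset]
  · rfl
  · intro w hw w' hw' hww'
    refine Set.disjoint_iUnion_left.2 fun m => Set.disjoint_iUnion_right.2 fun m' => ?_
    exact disjoint_entryEvent (.inl hw) (.inl hw') fun h => hww' (congrArg Prod.snd h)
  · exact fun w _ => .iUnion fun m => measurableSet_entryEvent hX hF m w

lemma sum_entryProb_eq_one [IsProbabilityMeasure μ] (hX : ∀ m, Measurable (X m))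
    (F : Finset S) (hfin : ∀ᵐ ω ∂μ, hitTime X F ω ≠ ⊤) : ∑ w ∈ F, entryProb μ X F w = 1 := by
  have hempty : {ω | hitTime X F ω < hitTime X (∅ : Finset S) ω} =ᵐ[μ] Set.univ := by
    filter_upwards [hfin] with ω hω
    have htop : hitTime X (∅ : Finset S) ω = ⊤ := by
      rw [hitTime, Finset.coe_empty, hittingAfter_empty]
      rfl
    exact eq_true (htop ▸ hω.lt_top : hitTime X F ω < hitTime X (∅ : Finset S) ω)
  have h := measureReal_hitTime_lt (μ := μ) hX (Finset.disjoint_empty_right F)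
  rw [measureReal_congr hempty, probReal_univ] at h
  simpa using h.symm

end HittingTimes

section ConsecutiveLetters

variable {Ω W : Type*} {ξ : ℕ → Ω → W}

/-- The process of the pairs of two consecutive letters. -/
def consecutive (ξ : ℕ → Ω → W) (m : ℕ) (ω : Ω) : W × W :=
  (ξ m ω, ξ (m + 1) ω)

lemma consecutive_preimage_singleton (m : ℕ) (y z : W) :
    consecutive ξ m ⁻¹' {(y, z)} = ξ m ⁻¹' {y} ∩ ξ (m + 1) ⁻¹' {z} := by
  ext; simp [consecutive]

variable [MeasurableSpace W]

/-- The σ-algebra generated by the letters `ξ 0, …, ξ m`. -/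
abbrev past (ξ : ℕ → Ω → W) (m : ℕ) : MeasurableSpace Ω :=
  ⨆ k ∈ Set.Iic m, MeasurableSpace.comap (ξ k) inferInstance

lemma measurable_past {k m : ℕ} (h : k ≤ m) : Measurable[past ξ m] (ξ k) :=
  measurable_iff_comap_le.2 (le_iSup₂_of_le k h le_rfl)

lemma measurable_past_consecutive {k m : ℕ} (h : k < m) :
    Measurable[past ξ m] (consecutive ξ k) :=
  (measurable_past h.le).prodMk (measurable_past h)

variable [MeasurableSpace Ω] [Fintype W] {μ : Measure Ω}

/-- The letters `ξ 0, ξ 1, …` are independent and uniformly distributed on the alphabet `W`. -/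
structure IsUniformIID (μ : Measure Ω) (ξ : ℕ → Ω → W) : Prop where
  measurable : ∀ m, Measurable (ξ m)
  iIndepFun : iIndepFun ξ μ
  measureReal_preimage : ∀ m y, μ.real (ξ m ⁻¹' {y}) = (Fintype.card W : ℝ)⁻¹

lemma exists_isUniformIID (W : Type v) [Fintype W] [Nonempty W] [MeasurableSpace W]
    [MeasurableSingletonClass W] :
    ∃ (Ω : Type u) (_ : MeasurableSpace Ω) (μ : Measure Ω) (_ : IsProbabilityMeasure μ)
      (ξ : ℕ → Ω → W), IsUniformIID μ ξ := by
  have : NeZero (Fintype.card W) := ⟨Fintype.card_ne_zero⟩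
  let e := (Fintype.equivFin W).symm
  obtain ⟨Ω, _, μ, η, hη, hlaw, hindep, hμ⟩ :=
    exists_iid (ULift.{u} ℕ) (PMF.uniformOfFintype (Fin (Fintype.card W))).toMeasure
  have he : Measurable e := measurable_of_finite e
  refine ⟨Ω, _, μ, hμ, fun m => e ∘ η ⟨m⟩, fun m => he.comp (hη _),
    (hindep.precomp ULift.up_injective).comp (fun _ => e) fun _ => he, fun m y => ?_⟩
  have hpreimage : e ⁻¹' {y} = {e.symm y} := by ext; simp [e.eq_symm_apply]
  rw [Set.preimage_comp, hpreimage, measureReal_def, ← Measure.map_apply (hη _) (by simp),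
    (hlaw ⟨m⟩).map_eq, PMF.toMeasure_apply_singleton _ _ (by simp)]
  simp

lemma IsUniformIID.measurable_consecutive (hξ : IsUniformIID μ ξ) (m : ℕ) :
    Measurable (consecutive ξ m) :=
  (hξ.measurable m).prodMk (hξ.measurable (m + 1))

variable [MeasurableSingletonClass W]

lemma IsUniformIID.measureReal_inter_succ (hξ : IsUniformIID μ ξ) {m : ℕ} {D : Set Ω}
    (hD : MeasurableSet[past ξ m] D) (y : W) :
    μ.real (D ∩ ξ (m + 1) ⁻¹' {y}) = μ.real D / Fintype.card W := by
  have hindep := indep_iSup_of_disjoint (fun k => (hξ.measurable k).comap_le) hξ.iIndepFun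
    (S := Set.Iic m) (T := {m + 1}) (by simp)
  have hinter := (Indep_iff _ _ _).1 hindep D (ξ (m + 1) ⁻¹' {y}) hD
    (measurable_iff_comap_le.2 (le_iSup₂_of_le (m + 1) (Set.mem_singleton _) le_rfl)
      (measurableSet_singleton y))
  rw [measureReal_def, hinter, ENNReal.toReal_mul, ← measureReal_def, ← measureReal_def,
    hξ.measureReal_preimage, div_eq_mul_inv]

lemma IsUniformIID.measureReal_consecutive_preimage (hξ : IsUniformIID μ ξ) (m : ℕ) (w : W × W) :
    μ.real (consecutive ξ m ⁻¹' {w}) = (Fintype.card W : ℝ)⁻¹ ^ 2 := by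
  rw [← w.eta, consecutive_preimage_singleton,
    hξ.measureReal_inter_succ (measurable_past le_rfl (measurableSet_singleton _)),
    hξ.measureReal_preimage]
  ring

lemma IsUniformIID.identDistrib_consecutive [IsFiniteMeasure μ] (hξ : IsUniformIID μ ξ)
    (m : ℕ) : IdentDistrib (consecutive ξ m) (consecutive ξ 0) μ μ := by
  refine ⟨(hξ.measurable_consecutive m).aemeasurable, (hξ.measurable_consecutive 0).aemeasurable,
    Measure.ext_of_singleton fun w => ?_⟩
  rw [Measure.map_apply (hξ.measurable_consecutive m) (measurableSet_singleton w),
    Measure.map_apply (hξ.measurable_consecutive 0) (measurableSet_singleton w),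
    ← measureReal_eq_measureReal_iff, hξ.measureReal_consecutive_preimage,
    hξ.measureReal_consecutive_preimage]

open Classical in
lemma IsUniformIID.measureReal_consecutive_path_succ (hξ : IsUniformIID μ ξ) (m : ℕ)
    (x : ℕ → W × W) :
    μ.real {ω | ∀ i ≤ m + 1, consecutive ξ i ω = x i} =
      μ.real {ω | ∀ i ≤ m, consecutive ξ i ω = x i} *
        if (x m).2 = (x (m + 1)).1 then (Fintype.card W : ℝ)⁻¹ else 0 := by
  have hpast : MeasurableSet[past ξ (m + 1)] {ω | ∀ i ≤ m, consecutive ξ i ω = x i} := by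
    simp only [Set.ofPred_forall]
    exact .biInter (Set.to_countable _) fun i hi =>
      measurable_past_consecutive (Nat.lt_succ_of_le hi) (measurableSet_singleton (x i))
  have hstep : {ω | ∀ i ≤ m + 1, consecutive ξ i ω = x i} =
      {ω | (∀ i ≤ m, consecutive ξ i ω = x i) ∧ consecutive ξ (m + 1) ω = x (m + 1)} := by
    simp only [Nat.le_succ_iff, or_imp, forall_and, forall_eq]
  split_ifs with hx
  · rw [← div_eq_mul_inv, ← hξ.measureReal_inter_succ hpast (x (m + 1)).2, hstep]
    congr 1
    ext ω
    refine and_congr_right fun hω => ?_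
    have hm : ξ (m + 1) ω = (x (m + 1)).1 := hx ▸ congrArg Prod.snd (hω m le_rfl)
    simp [consecutive, Prod.ext_iff, hm]
  · rw [mul_zero, ← measureReal_empty (μ := μ), hstep]
    congr 1
    refine Set.eq_empty_iff_forall_notMem.2 fun ω ⟨hω, hω'⟩ => hx ?_
    rw [← hω m le_rfl, ← hω']
    rfl

open Classical in
theorem IsUniformIID.isOneDependentUniformChain_consecutive [IsFiniteMeasure μ]
    (hξ : IsUniformIID μ ξ) : IsOneDependentUniformChain μ (consecutive ξ) := by
  refine ⟨Matrix.of fun w w' => if w.2 = w'.1 then (Fintype.card W : ℝ)⁻¹ else 0,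
    ⟨⟨fun w w' => ?_, fun w => ?_⟩, hξ.measurable_consecutive, fun m x => ?_⟩,
    hξ.identDistrib_consecutive, (Fintype.card W : ℝ)⁻¹ ^ 2, fun w w' => ?_⟩
  · rw [Matrix.of_apply]
    positivity
  · have : Nonempty W := ⟨w.1⟩
    simp [Fintype.sum_prod_type_right]
  · induction m with
    | zero => simp
    | succ m ih =>
      rw [Finset.prod_range_succ, ← mul_assoc, ← ih, hξ.measureReal_consecutive_path_succ,
        Matrix.of_apply]
  · simp [Matrix.mul_apply, Fintype.sum_prod_type, sq]

end ConsecutiveLetters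

section Renewal

variable {Ω W : Type*} [MeasurableSpace Ω] [Fintype W] {μ : Measure Ω} {ξ : ℕ → Ω → W}
  {F : Finset (W × W)}

/-- The expected number of times `m`, with `m = 0` counted twice, before which `F` has not been
visited, divided by the number of pairs of letters: the probability to enter `F` in a pair whose
first letter does not complete any pair of `F`. -/
noncomputable def freeEntryProb (μ : Measure Ω) (ξ : ℕ → Ω → W) (F : Set (W × W)) : ℝ :=
  (1 + ∑' m, survivalProb μ (consecutive ξ) F m) / (Fintype.card W : ℝ) ^ 2

lemma freeEntryProb_pos [Nonempty W] (F : Set (W × W)) : 0 < freeEntryProb μ ξ F := by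
  have : 0 ≤ ∑' m, survivalProb μ (consecutive ξ) F m := tsum_nonneg fun _ => measureReal_nonneg
  unfold freeEntryProb
  positivity

variable [MeasurableSpace W] [MeasurableSingletonClass W]

lemma IsUniformIID.entryProbAt_zero (hξ : IsUniformIID μ ξ) (F : Set (W × W)) (w : W × W) :
    entryProbAt μ (consecutive ξ) F 0 w = (Fintype.card W : ℝ)⁻¹ ^ 2 := by
  simpa [entryProbAt, entryEvent] using hξ.measureReal_consecutive_preimage 0 w

variable [IsProbabilityMeasure μ]

/-- The renewal equation: if `F` has not been visited before time `m` and the next two letters are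
those of `w`, then `w` is entered at time `m + 1` unless its first letter completes a pair of
`F`. -/
lemma IsUniformIID.entryProbAt_succ [DecidableEq W] (hξ : IsUniformIID μ ξ) (F : Finset (W × W))
    (m : ℕ) (w : W × W) :
    entryProbAt μ (consecutive ξ) F (m + 1) w =
      (survivalProb μ (consecutive ξ) F m / Fintype.card W -
        ∑ w' ∈ F with w'.2 = w.1, entryProbAt μ (consecutive ξ) F m w') / Fintype.card W := by
  set Z := {ω | m ≤ hitTime (consecutive ξ) F ω}
  have hZ : MeasurableSet[past ξ m] Z :=
    measurableSet_natCast_le_hitTime (fun k hk => measurable_past_consecutive hk) F.measurableSet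
  set D := Z ∩ ξ (m + 1) ⁻¹' {w.1}
  have hD : MeasurableSet[past ξ (m + 1)] (D \ consecutive ξ m ⁻¹' F) := by
    refine MeasurableSet.diff (MeasurableSet.inter ?_ ?_) ?_
    · exact measurableSet_natCast_le_hitTime
        (fun k hk => measurable_past_consecutive (hk.trans m.lt_succ_self)) F.measurableSet
    · exact measurable_past le_rfl (measurableSet_singleton w.1)
    · exact measurable_past_consecutive m.lt_succ_self F.measurableSet
  have hentry : entryEvent (consecutive ξ) F (m + 1) w =
      (D \ consecutive ξ m ⁻¹' F) ∩ ξ (m + 2) ⁻¹' {w.2} := by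
    ext ω
    simp only [entryEvent, natCast_succ_le_hitTime_iff, D, Z]
    simp [consecutive, Prod.ext_iff]
    tauto
  have hfilter : D ∩ consecutive ξ m ⁻¹' F =
      Z ∩ consecutive ξ m ⁻¹' (F.filter fun w' => w'.2 = w.1) := by
    ext ω
    simp [D, consecutive]
    tauto
  have hsdiff := measureReal_sdiff_add_inter (μ := μ) (s := D)
    (hξ.measurable_consecutive m F.measurableSet)
  rw [hfilter, measureReal_inter_preimage_finset hξ.measurable_consecutive,
    hξ.measureReal_inter_succ hZ] at hsdiff
  rw [entryProbAt, hentry, hξ.measureReal_inter_succ hD, eq_sub_of_add_eq hsdiff]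
  rfl

lemma IsUniformIID.summable_survivalProb (hξ : IsUniformIID μ ξ) (hF : F.Nonempty) :
    Summable (survivalProb μ (consecutive ξ) F) := by
  classical
  obtain ⟨w, hw⟩ := hF
  have : Nonempty W := ⟨w.1⟩
  have hentry {w : W × W} (hw : w ∈ F) : Summable (entryProbAt μ (consecutive ξ) F · w) :=
    (hasSum_entryProbAt hξ.measurable_consecutive F.measurableSet hw).summable
  have hsurvival (m : ℕ) : survivalProb μ (consecutive ξ) F m = Fintype.card W *
      (Fintype.card W * entryProbAt μ (consecutive ξ) F (m + 1) w +
        ∑ w' ∈ F with w'.2 = w.1, entryProbAt μ (consecutive ξ) F m w') := by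
    rw [hξ.entryProbAt_succ]
    field_simp
    ring
  rw [funext hsurvival]
  exact (((summable_nat_add_iff 1).2 (hentry hw)).mul_left _ |>.add
    (summable_sum fun w' hw' => hentry (Finset.mem_of_mem_filter w' hw'))).mul_left _

lemma IsUniformIID.ae_hitTime_ne_top (hξ : IsUniformIID μ ξ) (hF : F.Nonempty) :
    ∀ᵐ ω ∂μ, hitTime (consecutive ξ) F ω ≠ ⊤ := by
  suffices h : μ.real {ω | hitTime (consecutive ξ) F ω = ⊤} = 0 by
    simpa [ae_iff, measureReal_eq_zero_iff] using h
  refine le_antisymm (ge_of_tendsto' (hξ.summable_survivalProb hF).tendsto_atTop_zero fun m => ?_)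
    measureReal_nonneg
  exact measureReal_mono fun ω (hω : _ = ⊤) => le_top.trans_eq hω.symm

lemma IsUniformIID.entryProb_eq [DecidableEq W] (hξ : IsUniformIID μ ξ) {w : W × W}
    (hw : w ∈ F) :
    entryProb μ (consecutive ξ) F w = freeEntryProb μ ξ F -
      (∑ w' ∈ F with w'.2 = w.1, entryProb μ (consecutive ξ) F w') / Fintype.card W := by
  have hentry {w : W × W} (hw : w ∈ F) : HasSum (entryProbAt μ (consecutive ξ) F · w)
      (entryProb μ (consecutive ξ) F w) :=
    hasSum_entryProbAt hξ.measurable_consecutive F.measurableSet hw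
  have hsurvival := (hξ.summable_survivalProb ⟨w, hw⟩).hasSum.div_const (Fintype.card W : ℝ)
  have hshift := (hsurvival.sub (hasSum_sum fun w' hw' =>
    hentry (Finset.mem_of_mem_filter (p := fun w' => w'.2 = w.1) w' hw'))).div_const
      (Fintype.card W : ℝ)
  simp only [← hξ.entryProbAt_succ] at hshift
  rw [(hentry hw).unique (HasSum.zero_add (f := (entryProbAt μ (consecutive ξ) F · w)) hshift),
    hξ.entryProbAt_zero, freeEntryProb]
  ring

lemma IsUniformIID.survivalProb_add_two (hξ : IsUniformIID μ ξ)
    (hF : ∀ w ∈ F, ∀ w' ∈ F, w.2 ≠ w'.1) (m : ℕ) :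
    survivalProb μ (consecutive ξ) F (m + 2) = survivalProb μ (consecutive ξ) F (m + 1) -
      F.card * survivalProb μ (consecutive ξ) F m / (Fintype.card W : ℝ) ^ 2 := by
  have hentry : ∀ w ∈ F, entryProbAt μ (consecutive ξ) F (m + 1) w =
      survivalProb μ (consecutive ξ) F m / (Fintype.card W : ℝ) ^ 2 := by
    classical
    intro w hw
    rw [hξ.entryProbAt_succ, Finset.filter_false_of_mem fun w' hw' => hF w' hw' w hw]
    ring
  rw [← survivalProb_succ_add hξ.measurable_consecutive F (m + 1), Finset.sum_congr rfl hentry,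
    Finset.sum_const]
  ring

lemma IsUniformIID.survivalProb_one (hξ : IsUniformIID μ ξ) (F : Finset (W × W)) :
    survivalProb μ (consecutive ξ) F 1 = 1 - F.card / (Fintype.card W : ℝ) ^ 2 := by
  have h := survivalProb_succ_add (μ := μ) hξ.measurable_consecutive F 0
  simp only [hξ.entryProbAt_zero, survivalProb_zero, Finset.sum_const, nsmul_eq_mul] at h
  rw [eq_sub_of_add_eq h]
  ring

lemma IsUniformIID.identDistrib_hitTime (hξ : IsUniformIID μ ξ) {F' : Finset (W × W)}
    (hF : ∀ w ∈ F, ∀ w' ∈ F, w.2 ≠ w'.1) (hF' : ∀ w ∈ F', ∀ w' ∈ F', w.2 ≠ w'.1)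
    (hcard : F.card = F'.card) :
    IdentDistrib (hitTime (consecutive ξ) F) (hitTime (consecutive ξ) F') μ μ := by
  refine identDistrib_of_measureReal_natCast_le_eq
    (measurable_hitTime hξ.measurable_consecutive F.measurableSet)
    (measurable_hitTime hξ.measurable_consecutive F'.measurableSet) fun m => ?_
  change survivalProb μ (consecutive ξ) F m = survivalProb μ (consecutive ξ) F' m
  induction m using Nat.twoStepInduction with
  | zero => rw [survivalProb_zero, survivalProb_zero]
  | one => rw [hξ.survivalProb_one, hξ.survivalProb_one, hcard]
  | more m ih ih' => rw [hξ.survivalProb_add_two hF, hξ.survivalProb_add_two hF', ih, ih', hcard]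

end Renewal

section Words

variable {V : Type}

/-- The letters are the pairs of vertices and one blank letter, lifted to the universe in which the
states of the chain are sought. -/
abbrev Alphabet (V : Type) : Type v :=
  ULift.{v} (Option (V × V))

open Classical in
/-- The pair of consecutive letters which encodes the pair `(i, j)` of vertices: its first letter
is `(i, j)`, and its second letter is `(j, i)` if there is an arrow from `j` to `i`, and blank
otherwise. -/
noncomputable def word (G : Digraph V) : V × V ↪ Alphabet.{v} V × Alphabet.{v} V where
  toFun p := (⟨some p⟩, ⟨if G.Adj p.2 p.1 then some p.swap else none⟩)
  inj' p p' h := by simpa using congrArg Prod.fst h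

lemma word_snd_eq_word_fst_iff {G : Digraph V} {p p' : V × V} :
    (word.{v} G p').2 = (word G p).1 ↔ p' = p.swap ∧ G.Adj p.1 p.2 := by
  classical
  obtain ⟨i, j⟩ := p
  obtain ⟨i', j'⟩ := p'
  change ULift.up (if G.Adj j' i' then some (j', i') else none) = ULift.up (some (i, j)) ↔ _
  grind [Prod.swap_prod_mk]

variable [Fintype V]

/-- The words `(i, j)` with `i ∈ C`. The hitting time of `words G {i}` is the `i`-th one of the
game. -/
noncomputable def words (G : Digraph V) (C : Finset V) :
    Finset (Alphabet.{v} V × Alphabet.{v} V) :=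
  (C ×ˢ Finset.univ).map (word G)

variable {G : Digraph V} {A B C : Finset V}

lemma word_mem_words {p : V × V} : word.{v} G p ∈ words G C ↔ p.1 ∈ C := by
  simp [words]

lemma card_words_singleton (i : V) : (words.{v} G {i}).card = Fintype.card V := by
  simp [words]

lemma disjoint_words (h : Disjoint A B) : Disjoint (words.{v} G A) (words G B) :=
  (Finset.disjoint_map _).2 (Finset.disjoint_product.2 (.inl h))

lemma words_union [DecidableEq V] : words.{v} G (A ∪ B) = words G A ∪ words G B := by
  rw [words, Finset.union_product, Finset.map_union]
  rfl

lemma biUnion_words_singleton (A : Finset V) :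
    ⋃ i ∈ A, (words.{v} G {i} : Set (Alphabet V × Alphabet V)) = words G A := by
  ext w
  simp [words]

lemma words_nonempty (h : C.Nonempty) : (words.{v} G C).Nonempty := by
  obtain ⟨i, hi⟩ := h
  exact ⟨word G (i, i), word_mem_words.2 hi⟩

lemma snd_ne_fst_of_mem_words_singleton (hG : ∀ i, ¬ G.Adj i i) (i : V) :
    ∀ w ∈ words.{v} G {i}, ∀ w' ∈ words.{v} G {i}, w.2 ≠ w'.1 := by
  simp only [words, Finset.forall_mem_map, Finset.mem_product, Finset.mem_singleton]
  rintro p ⟨hp, -⟩ p' ⟨hp', -⟩ h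
  obtain ⟨rfl, hadj⟩ := word_snd_eq_word_fst_iff.1 h
  rw [hp', show p'.2 = i from hp] at hadj
  exact hG i hadj

variable [DecidableRel G.Adj]

lemma filter_words_snd_eq_word_fst [DecidableEq V] (p : V × V) :
    (words.{v} G C).filter (fun w => w.2 = (word G p).1) =
      if G.Adj p.1 p.2 ∧ p.2 ∈ C then {word G p.swap} else ∅ := by
  rw [words, Finset.filter_map]
  split_ifs with h
  · rw [← Finset.map_singleton]
    congr 1
    refine Finset.eq_singleton_iff_unique_mem.2 ⟨?_, fun p' hp' => ?_⟩
    · simp [word_snd_eq_word_fst_iff, h]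
    · exact (word_snd_eq_word_fst_iff.1 (Finset.mem_filter.1 hp').2).1
  · rw [Finset.map_eq_empty, Finset.filter_eq_empty_iff]
    rintro p' hp' hw
    obtain ⟨rfl, hadj⟩ := word_snd_eq_word_fst_iff.1 hw
    exact h ⟨hadj, (Finset.mem_product.1 hp').1⟩

variable [MeasurableSpace (Alphabet.{v} V)] [MeasurableSingletonClass (Alphabet.{v} V)]
  {Ω : Type*} [MeasurableSpace Ω] {μ : Measure Ω} [IsProbabilityMeasure μ]
  {ξ : ℕ → Ω → Alphabet.{v} V}

lemma IsUniformIID.entryProb_word [DecidableEq V] (hξ : IsUniformIID μ ξ)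
    (hG : ∀ i j, G.Adj i j → ¬ G.Adj j i) {p : V × V} (hp : p.1 ∈ C) :
    entryProb μ (consecutive ξ) (words G C) (word G p) = freeEntryProb μ ξ (words G C) -
      if G.Adj p.1 p.2 ∧ p.2 ∈ C then
        freeEntryProb μ ξ (words G C) / Fintype.card (Alphabet.{v} V) else 0 := by
  have hfree {p : V × V} (hp : p.1 ∈ C) (h : ¬ (G.Adj p.1 p.2 ∧ p.2 ∈ C)) :
      entryProb μ (consecutive ξ) (words G C) (word G p) = freeEntryProb μ ξ (words G C) := by
    rw [hξ.entryProb_eq (word_mem_words.2 hp), filter_words_snd_eq_word_fst, if_neg h,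
      Finset.sum_empty, zero_div, sub_zero]
  split_ifs with h
  · rw [hξ.entryProb_eq (word_mem_words.2 hp), filter_words_snd_eq_word_fst, if_pos h,
      Finset.sum_singleton, hfree (p := p.swap) h.2 fun h' => hG _ _ h.1 h'.1]
  · rw [hfree hp h, sub_zero]

lemma IsUniformIID.sum_entryProb_words (hξ : IsUniformIID μ ξ)
    (hG : ∀ i j, G.Adj i j → ¬ G.Adj j i) (hAC : A ⊆ C) :
    ∑ w ∈ words G A, entryProb μ (consecutive ξ) (words G C) w =
      freeEntryProb μ ξ (words G C) * (A.card * Fintype.card V -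
        (Rel.interedges G.Adj A C).card / Fintype.card (Alphabet.{v} V)) := by
  classical
  have hinteredges : (A ×ˢ Finset.univ).filter (fun p => G.Adj p.1 p.2 ∧ p.2 ∈ C) =
      Rel.interedges G.Adj A C := by
    ext p
    simp [Rel.mem_interedges_iff]
    tauto
  rw [words, Finset.sum_map, Finset.sum_congr rfl fun p hp =>
    hξ.entryProb_word hG (hAC (Finset.mem_product.1 hp).1), Finset.sum_sub_distrib,
    ← Finset.sum_filter, hinteredges, Finset.sum_const, Finset.sum_const, Finset.card_product,
    Finset.card_univ]
  simp only [nsmul_eq_mul, Nat.cast_mul]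
  ring

end Words

section Construction

variable {n r₁ r₂ : ℕ} {G : Digraph (Fin n)} {A B : Finset (Fin n)}

lemma card_mul_card_interedges_lt {V : Type*} [DecidableEq V] {G : Digraph V}
    [DecidableRel G.Adj] {A B : Finset V} (hG : ∀ i j, G.Adj i j → ¬ G.Adj j i) (hA : A.Nonempty)
    (hB : B.Nonempty) (hadj : ∀ i ∈ A, ∀ j ∈ B, G.Adj i j) :
    A.card * (Rel.interedges G.Adj B (A ∪ B)).card <
      B.card * (Rel.interedges G.Adj A (A ∪ B)).card := by
  have hlower : A ×ˢ B ⊆ Rel.interedges G.Adj A (A ∪ B) := by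
    grind [Rel.mem_interedges_iff]
  have hupper : Rel.interedges G.Adj B (A ∪ B) ⊂ B ×ˢ B := by
    obtain ⟨b, hb⟩ := hB
    refine Finset.ssubset_iff_of_subset ?_ |>.2 ⟨(b, b), ?_, ?_⟩
    all_goals grind [Rel.mem_interedges_iff]
  calc A.card * (Rel.interedges G.Adj B (A ∪ B)).card
      < A.card * (B ×ˢ B).card := by gcongr
    _ = B.card * (A ×ˢ B).card := by rw [Finset.card_product, Finset.card_product]; ring
    _ ≤ B.card * (Rel.interedges G.Adj A (A ∪ B)).card := by gcongr

variable {Ω : Type*} [MeasurableSpace Ω] {μ : Measure Ω} [IsProbabilityMeasure μ]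
  [MeasurableSpace (Alphabet.{v} (Fin n))] [MeasurableSingletonClass (Alphabet.{v} (Fin n))]
  {ξ : ℕ → Ω → Alphabet.{v} (Fin n)}

lemma IsUniformIID.measureReal_minTime_words_lt (hξ : IsUniformIID μ ξ) (hAB : Disjoint A B) :
    μ.real {ω | minTime (fun i => hitTime (consecutive ξ) (words G {i})) A ω <
        minTime (fun i => hitTime (consecutive ξ) (words G {i})) B ω} =
      ∑ w ∈ words G A, entryProb μ (consecutive ξ) (words G (A ∪ B)) w := by
  simp only [minTime_hitTime, biUnion_words_singleton, words_union, Finset.coe_union]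
  exact measureReal_hitTime_lt hξ.measurable_consecutive (disjoint_words hAB)

lemma IsUniformIID.sum_entryProb_words_add_sum_entryProb_words (hξ : IsUniformIID μ ξ)
    (hA : A.Nonempty) (hAB : Disjoint A B) :
    ∑ w ∈ words G A, entryProb μ (consecutive ξ) (words G (A ∪ B)) w +
      ∑ w ∈ words G B, entryProb μ (consecutive ξ) (words G (A ∪ B)) w = 1 := by
  rw [← Finset.sum_union (disjoint_words hAB), ← words_union]
  exact sum_entryProb_eq_one hξ.measurable_consecutive _
    (hξ.ae_hitTime_ne_top (words_nonempty hA.inl))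

lemma IsUniformIID.expectedPayoff_words [DecidableRel G.Adj] (hξ : IsUniformIID μ ξ)
    (hG : ∀ i j, G.Adj i j → ¬ G.Adj j i) (hA : A.Nonempty) (hAB : Disjoint A B) :
    expectedPayoff μ (fun i => hitTime (consecutive ξ) (words G {i})) A B =
      freeEntryProb μ ξ (words G (A ∪ B)) / Fintype.card (Alphabet.{v} (Fin n)) *
        (B.card * (Rel.interedges G.Adj A (A ∪ B)).card -
          A.card * (Rel.interedges G.Adj B (A ∪ B)).card) := by
  have hT (i : Fin n) : AEMeasurable (hitTime (consecutive ξ) (words G {i})) μ :=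
    (measurable_hitTime hξ.measurable_consecutive (words G {i}).measurableSet).aemeasurable
  rw [expectedPayoff_eq hT, hξ.measureReal_minTime_words_lt hAB,
    ← hξ.sum_entryProb_words_add_sum_entryProb_words (G := G) hA hAB,
    hξ.sum_entryProb_words hG Finset.subset_union_left,
    hξ.sum_entryProb_words hG Finset.subset_union_right]
  ring

lemma IsUniformIID.isFavorable_words (hξ : IsUniformIID μ ξ)
    (hG : ∀ i j, G.Adj i j → ¬ G.Adj j i) (hdir : IsDirectional G r₁ r₂)
    (hr₁ : 1 ≤ r₁) (hr₂ : 1 ≤ r₂) (hn : r₁ + r₂ ≤ n) :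
    IsFavorable μ (fun i => hitTime (consecutive ξ) (words G {i})) r₁ r₂ := by
  classical
  refine ⟨hn, (gameValue_pos_iff hr₁ hr₂ hn).2 fun A hA => ?_⟩
  obtain ⟨B, hB, hAB, hadj⟩ := hdir A hA
  refine ⟨B, hB, hAB, fun A' hA' B' hB' hA'ne hB'ne => ?_⟩
  have hcard := card_mul_card_interedges_lt hG hA'ne hB'ne
    fun i hi j hj => hadj i (hA' hi) j (hB' hj)
  rw [hξ.expectedPayoff_words hG hA'ne (hAB.mono hA' hB')]
  have := freeEntryProb_pos (μ := μ) (ξ := ξ) (words G (A' ∪ B'))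
  exact mul_pos (by positivity) (sub_pos.2 (mod_cast hcard))

lemma IsUniformIID.noTie_words (hξ : IsUniformIID μ ξ) :
    NoTie μ fun i => hitTime (consecutive ξ) (words G {i}) := by
  intro i j hij
  filter_upwards [hξ.ae_hitTime_ne_top (words_nonempty (Finset.singleton_nonempty i))] with ω hω
  exact hitTime_ne_of_disjoint
    (Finset.disjoint_coe.2 (disjoint_words (Finset.disjoint_singleton.2 hij))) hω

lemma IsUniformIID.identicallyDistributed_words (hξ : IsUniformIID μ ξ)
    (hG : ∀ i, ¬ G.Adj i i) :
    IdenticallyDistributed μ fun i => hitTime (consecutive ξ) (words G {i}) := fun i j =>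
  hξ.identDistrib_hitTime (snd_ne_fst_of_mem_words_singleton hG i)
    (snd_ne_fst_of_mem_words_singleton hG j) (by rw [card_words_singleton, card_words_singleton])

end Construction

end PenneyGame

theorem theorem4p1 (r₁ r₂ : ℕ) (hr₁ : 1 ≤ r₁) (hr₂ : 1 ≤ r₂) :
    (directionalOrders r₁ r₂).Nonempty ∧
    ∀ n : ℕ,
      (∃ (Ω : Type u) (_ : MeasurableSpace Ω) (μ : Measure Ω) (_ : IsProbabilityMeasure μ)
          (S : Type v) (_ : Fintype S) (_ : MeasurableSpace S) (_ : DiscreteMeasurableSpace S)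
          (X : ℕ → Ω → S) (F : Fin n → Set S),
        IsOneDependentUniformChain μ X ∧
        NoTie μ (fun i => hitTime X (F i)) ∧
        IdenticallyDistributed μ (fun i => hitTime X (F i)) ∧
        IsFavorable μ (fun i => hitTime X (F i)) r₁ r₂) ↔
      threshold r₁ r₂ ≤ n := by
  refine ⟨directionalOrders_nonempty r₁ r₂, fun n => ⟨?_, fun hn => ?_⟩⟩
  · rintro ⟨Ω, _, μ, _, S, _, _, _, X, F, -, hnt, hid, hfav⟩
    exact Nat.sInf_le <| mem_directionalOrders_of_isFavorable
      (fun i => (hid i i).aemeasurable_fst) hnt hr₁ hr₂ hfav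
  · obtain ⟨hrn, G, hG, hdir⟩ :=
      mem_directionalOrders_of_le hr₁ (Nat.sInf_mem (directionalOrders_nonempty r₁ r₂)) hn
    have hasymm (i j : Fin n) (h : G.Adj i j) : ¬ G.Adj j i := hG.not_adj_of_adj h
    let _ : MeasurableSpace (Alphabet.{v} (Fin n)) := ⊤
    obtain ⟨Ω, _, μ, _, ξ, hξ⟩ := exists_isUniformIID.{u, v} (Alphabet (Fin n))
    exact ⟨Ω, _, μ, ‹_›, _, inferInstance, inferInstance, inferInstance, consecutive ξ,
      fun i => words G {i}, hξ.isOneDependentUniformChain_consecutive, hξ.noTie_words,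
      hξ.identicallyDistributed_words hG.1, hξ.isFavorable_words hasymm hdir hr₁ hr₂ hrn⟩
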